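/- Let $F$ be a field of characteristic $0$. A pro-algebraic group over $F$ is an affine group scheme over $F$, i.e. $Q=\operatorname{Spec}H$ for a commutative Hopf algebra $H$ over $F$; for a commutative $F$-algebra $\Lambda$ write $Q(\Lambda)=\operatorname{Hom}_{F\text{-alg}}(H,\Lambda)$. Let $\mathcal{C}$ be an $F$-linear category. For a commutative $F$-algebra $\Lambda$ let $\mathcal{C}_\Lambda$ be the category with the same objects (an object $C$ is then written $C\otimes\Lambda$) and with $\operatorname{Hom}_{\mathcal{C}_\Lambda}(C_1,C_2)=\operatorname{Hom}_{\mathcal{C}}(C_1,C_2)\otimes_F\Lambda$. An $F$-algebraic action of $Q$ on $\mathcal{C}$ consists, for every $\Lambda$, of an action of the group $Q(\Lambda)$ on $\mathcal{C}_\Lambda$ by $\Lambda$-linear functors $q\cdot-$, with natural isomorphisms $1\cdot-\cong\mathrm{id}$ and $q_2\cdot(q_1\cdot-)\cong(q_2q_1)\cdot-$ satisfying the usual unit and associativity conditions, functorially in $\Lambda$: for $\phi\colon\Lambda\to\Lambda'$ and $q\in Q(\Lambda)$, the functors $q\cdot-$ and $\phi(q)\cdot-$ commute with the transition functor $\mathcal{C}_\Lambda\to\mathcal{C}_{\Lambda'}$,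 up to given natural isomorphisms compatible with identities and composites of algebra homomorphisms and with the unit and multiplication isomorphisms of the actions. The category $\mathcal{C}^Q$ of $F$-algebraic equivariant objects has as objects the pairs $(C,\alpha)$ of an object $C\in\mathcal{C}$ and isomorphisms $\alpha_{\Lambda,q}\colon q\cdot(C\otimes\Lambda)\to C\otimes\Lambda$ in $\mathcal{C}_\Lambda$, for all $\Lambda$ and all $q\in Q(\Lambda)$, such that $\alpha_{\Lambda,1}$ is the canonical isomorphism, $\alpha_{\Lambda,q_2}\circ(q_2\cdot\alpha_{\Lambda,q_1})=\alpha_{\Lambda,q_2q_1}$ under the canonical identification $q_2\cdot(q_1\cdot-)\cong(q_2q_1)\cdot-$, and every $\phi\colon\Lambda\to\Lambda'$ carries $\alpha_{\Lambda,q}$ to $\alpha_{\Lambda',\phi(q)}$. Morphisms $(C_1,\alpha_1)\to(C_2,\alpha_2)$ are the morphisms $g\colon C_1\to C_2$ in $\mathcal{C}$ with $\alpha_{2,\Lambda,q}\circ(q\cdot g)=g\circ\alpha_{1,\Lambda,q}$ in $\mathcal{C}_\Lambda$ for all $\Lambda$ and all $q\in Q(\Lambda)$. **Lemma.** Let $f\colon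 Q_1\to Q_2$ be a morphism of pro-algebraic groups over $F$, let $Q_2$ act $F$-algebraically on an $F$-linear category $\mathcal{C}$, and let $Q_1$ act on $\mathcal{C}$ via $f$. Let $\operatorname{res}\colon\mathcal{C}^{Q_2}\to\mathcal{C}^{Q_1}$ be the restriction functor, $(C,(\alpha_{\Lambda,q})_{q\in Q_2(\Lambda)})\mapsto(C,(\alpha_{\Lambda,f(q)})_{q\in Q_1(\Lambda)})$, which is the identity on underlying morphisms of $\mathcal{C}$. Then: 1. $\operatorname{res}$ is faithful and conservative (it reflects isomorphisms). 2. If $f$ is an epimorphism in the category of pro-algebraic groups over $F$, then $\operatorname{res}$ is also full. -/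

import Mathlib

open CategoryTheory
open scoped TensorProduct

universe w v u

noncomputable section

namespace ProAlg

/-! ### Pro-algebraic groups and their points -/

/-- Pro-algebraic groups over the field `F`, i.e. affine group schemes over `F`, as the opposite of
the category of commutative Hopf algebras over `F`: the object `Q` stands for the spectrum of the
Hopf algebra `Q.unop`, its algebra of functions. -/
abbrev ProAlgGrp (F : Type u) [Field F] := (CommHopfAlgCat.{u} F)ᵒᵖ

section Points

variable {F : Type u} [Field F]

/-- The group `Q(Λ)` of `Λ`-valued points of `Q`: the algebra homomorphisms from the algebra of
functions of `Q` to `Λ`, with the convolution product. -/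
abbrev Pts (Q : ProAlgGrp F) (Λ : Type u) [CommRing Λ] [Algebra F Λ] : Type u :=
  WithConv ((Q.unop : Type u) →ₐ[F] Λ)

/-- The group structure of `Q(Λ)`; the inverse is composition with the antipode. -/
instance Pts.group (Q : ProAlgGrp F) (Λ : Type u) [CommRing Λ] [Algebra F Λ] :
    Group (Pts Q Λ) where
  inv q := WithConv.toConv (q.ofConv.comp (HopfAlgebra.antipodeAlgHom F Q.unop))
  inv_mul_cancel q := by
    apply WithConv.ofConv_injective
    have h := AlgHom.comp_convMul_distrib q.ofConv
      (WithConv.toConv (HopfAlgebra.antipodeAlgHom F Q.unop))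
      (WithConv.toConv (AlgHom.id F Q.unop))
    rw [AlgHom.antipode_id_cancel] at h
    refine Eq.trans h.symm ?_
    apply AlgHom.ext
    intro x
    simp [AlgHom.convOne_def, Algebra.ofId_apply]

/-- The group homomorphism `Q(Λ) → Q(Λ')` induced by an algebra homomorphism `φ : Λ → Λ'`. -/
def Pts.map (Q : ProAlgGrp F) {Λ Λ' : Type u} [CommRing Λ] [Algebra F Λ] [CommRing Λ']
    [Algebra F Λ'] (φ : Λ →ₐ[F] Λ') : Pts Q Λ →* Pts Q Λ' where
  toFun q := WithConv.toConv (φ.comp q.ofConv)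
  map_one' := by
    apply WithConv.ofConv_injective
    apply AlgHom.ext
    intro x
    simp [AlgHom.convOne_def, Algebra.ofId_apply]
  map_mul' q q' := by
    apply WithConv.ofConv_injective
    exact AlgHom.comp_convMul_distrib φ q q'

/-- The group homomorphism `Q₁(Λ) → Q₂(Λ)` induced by a morphism `f : Q₁ ⟶ Q₂`. -/
def Pts.push {Q₁ Q₂ : ProAlgGrp F} (f : Q₁ ⟶ Q₂) (Λ : Type u) [CommRing Λ] [Algebra F Λ] :
    Pts Q₁ Λ →* Pts Q₂ Λ where
  toFun q := WithConv.toConv (q.ofConv.comp (f.unop.hom : Q₂.unop →ₐ[F] Q₁.unop))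
  map_one' := by
    apply WithConv.ofConv_injective
    apply AlgHom.ext
    intro x
    simp [AlgHom.convOne_def, Algebra.ofId_apply]
  map_mul' q q' := by
    apply WithConv.ofConv_injective
    exact AlgHom.convMul_comp_bialgHom_distrib q q' f.unop.hom

theorem Pts.map_push {Q₁ Q₂ : ProAlgGrp F} (f : Q₁ ⟶ Q₂) {Λ Λ' : Type u} [CommRing Λ]
    [Algebra F Λ] [CommRing Λ'] [Algebra F Λ'] (φ : Λ →ₐ[F] Λ') (q : Pts Q₁ Λ) :
    Pts.map Q₂ φ (Pts.push f Λ q) = Pts.push f Λ' (Pts.map Q₁ φ q) :=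
  rfl

end Points

/-! ### Extension of scalars of a linear category -/

/-- The category `C_Λ`: it has the same objects as `C` (`⟨X⟩` is written `X ⊗ Λ` on paper) and its
morphisms from `X` to `Y` are the elements of `Λ ⊗ Hom(X, Y)`. -/
structure ExtCat (F : Type u) (C : Type w) (Λ : Type u) where
  /-- The underlying object of `C`. -/
  obj : C

section ExtCat

variable {F : Type u} [Field F] {C : Type w} [Category.{v} C] [Preadditive C] [Linear F C]
variable {Λ : Type u} [CommRing Λ] [Algebra F Λ]

/-- Composition in `C_Λ`, the bilinear map with `(a ⊗ f) ≫ (b ⊗ g) = ab ⊗ (f ≫ g)`. -/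
def ExtCat.compMap (F : Type u) [Field F] {C : Type w} [Category.{v} C] [Preadditive C]
    [Linear F C] (Λ : Type u) [CommRing Λ] [Algebra F Λ] (X Y Z : C) :
    (Λ ⊗[F] (X ⟶ Y)) →ₗ[F] (Λ ⊗[F] (Y ⟶ Z)) →ₗ[F] (Λ ⊗[F] (X ⟶ Z)) :=
  TensorProduct.map₂ (LinearMap.mul F Λ) (Linear.comp X Y Z)

@[simp]
theorem ExtCat.compMap_tmul {X Y Z : C} (a b : Λ) (f : X ⟶ Y) (g : Y ⟶ Z) :
    ExtCat.compMap F Λ X Y Z (a ⊗ₜ f) (b ⊗ₜ g) = (a * b) ⊗ₜ (f ≫ g) :=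
  rfl

theorem ExtCat.one_compMap {X Y : C} (x : Λ ⊗[F] (X ⟶ Y)) :
    ExtCat.compMap F Λ X X Y (1 ⊗ₜ 𝟙 X) x = x := by
  induction x with
  | zero => simp
  | tmul a f => simp
  | add x y hx hy => rw [map_add, hx, hy]

theorem ExtCat.compMap_one {X Y : C} (x : Λ ⊗[F] (X ⟶ Y)) :
    ExtCat.compMap F Λ X Y Y x (1 ⊗ₜ 𝟙 Y) = x := by
  induction x with
  | zero => simp
  | tmul a f => simp
  | add x y hx hy => rw [map_add, LinearMap.add_apply, hx, hy]

theorem ExtCat.compMap_assoc {W X Y Z : C} (x : Λ ⊗[F] (W ⟶ X)) (y : Λ ⊗[F] (X ⟶ Y))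
    (z : Λ ⊗[F] (Y ⟶ Z)) :
    ExtCat.compMap F Λ W Y Z (ExtCat.compMap F Λ W X Y x y) z =
      ExtCat.compMap F Λ W X Z x (ExtCat.compMap F Λ X Y Z y z) := by
  induction x with
  | zero => simp
  | add x x' hx hx' => simp only [map_add, LinearMap.add_apply, hx, hx']
  | tmul a f =>
    induction y with
    | zero => simp
    | add y y' hy hy' => simp only [map_add, LinearMap.add_apply, hy, hy']
    | tmul b g =>
      induction z with
      | zero => simp
      | add z z' hz hz' => simp only [map_add, hz, hz']
      | tmul c h => simp [mul_assoc]

theorem ExtCat.smul_compMap {X Y Z : C} (r : Λ) (x : Λ ⊗[F] (X ⟶ Y)) (y : Λ ⊗[F] (Y ⟶ Z)) :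
    ExtCat.compMap F Λ X Y Z (r • x) y = r • ExtCat.compMap F Λ X Y Z x y := by
  induction x with
  | zero => simp
  | add x x' hx hx' => simp only [smul_add, map_add, LinearMap.add_apply, hx, hx']
  | tmul a f =>
    induction y with
    | zero => simp
    | add y y' hy hy' => simp only [map_add, smul_add, hy, hy']
    | tmul b g => simp [TensorProduct.smul_tmul', mul_assoc]

theorem ExtCat.compMap_smul {X Y Z : C} (r : Λ) (x : Λ ⊗[F] (X ⟶ Y)) (y : Λ ⊗[F] (Y ⟶ Z)) :
    ExtCat.compMap F Λ X Y Z x (r • y) = r • ExtCat.compMap F Λ X Y Z x y := by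
  induction x with
  | zero => simp
  | add x x' hx hx' => simp only [smul_add, map_add, LinearMap.add_apply, hx, hx']
  | tmul a f =>
    induction y with
    | zero => simp
    | add y y' hy hy' => simp only [map_add, smul_add, hy, hy']
    | tmul b g => simp [TensorProduct.smul_tmul', mul_left_comm]

theorem ExtCat.map_compMap {Λ' : Type u} [CommRing Λ'] [Algebra F Λ'] (φ : Λ →ₐ[F] Λ')
    {X Y Z : C} (x : Λ ⊗[F] (X ⟶ Y)) (y : Λ ⊗[F] (Y ⟶ Z)) :
    TensorProduct.map φ.toLinearMap LinearMap.id (ExtCat.compMap F Λ X Y Z x y) =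
      ExtCat.compMap F Λ' X Y Z (TensorProduct.map φ.toLinearMap LinearMap.id x)
        (TensorProduct.map φ.toLinearMap LinearMap.id y) := by
  induction x with
  | zero => simp
  | add x x' hx hx' => simp only [map_add, LinearMap.add_apply, hx, hx']
  | tmul a f =>
    induction y with
    | zero => simp
    | add y y' hy hy' => simp only [map_add, hy, hy']
    | tmul b g => simp

instance ExtCat.category : Category.{max u v} (ExtCat F C Λ) where
  Hom X Y := Λ ⊗[F] (X.obj ⟶ Y.obj)
  id X := 1 ⊗ₜ 𝟙 X.obj
  comp x y := ExtCat.compMap F Λ _ _ _ x y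
  id_comp x := ExtCat.one_compMap x
  comp_id x := ExtCat.compMap_one x
  assoc x y z := ExtCat.compMap_assoc x y z

instance ExtCat.preadditive : Preadditive (ExtCat F C Λ) where
  homGroup X Y := inferInstanceAs (AddCommGroup (Λ ⊗[F] (X.obj ⟶ Y.obj)))
  add_comp X Y Z x x' y := (ExtCat.compMap F Λ X.obj Y.obj Z.obj).map_add₂ x x' y
  comp_add X Y Z x y y' := (ExtCat.compMap F Λ X.obj Y.obj Z.obj x).map_add y y'

instance ExtCat.linear : Linear Λ (ExtCat F C Λ) where
  homModule X Y := inferInstanceAs (Module Λ (Λ ⊗[F] (X.obj ⟶ Y.obj)))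
  smul_comp _ _ _ r x y := ExtCat.smul_compMap r x y
  comp_smul _ _ _ x r y := ExtCat.compMap_smul r x y

/-- A morphism of `C`, regarded as a morphism of `C_Λ`. -/
def ExtCat.incl (F : Type u) [Field F] {C : Type w} [Category.{v} C] [Preadditive C] [Linear F C]
    (Λ : Type u) [CommRing Λ] [Algebra F Λ] {X Y : C} (f : X ⟶ Y) :
    (⟨X⟩ : ExtCat F C Λ) ⟶ ⟨Y⟩ :=
  (1 : Λ) ⊗ₜ[F] f

theorem ExtCat.incl_id (X : C) : ExtCat.incl F Λ (𝟙 X) = 𝟙 (⟨X⟩ : ExtCat F C Λ) :=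
  rfl

theorem ExtCat.incl_comp {X Y Z : C} (f : X ⟶ Y) (g : Y ⟶ Z) :
    ExtCat.incl F Λ (f ≫ g) = ExtCat.incl F Λ f ≫ ExtCat.incl F Λ g := by
  change (1 : Λ) ⊗ₜ[F] (f ≫ g) = ((1 : Λ) * 1) ⊗ₜ[F] (f ≫ g)
  rw [mul_one]

/-- The transition functor `C_Λ ⥤ C_Λ'` of an algebra homomorphism `φ : Λ → Λ'`: the identity on
objects, `φ ⊗ id` on morphisms. -/
def ExtCat.trans (C : Type w) [Category.{v} C] [Preadditive C] [Linear F C] {Λ Λ' : Type u}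
    [CommRing Λ] [Algebra F Λ] [CommRing Λ'] [Algebra F Λ'] (φ : Λ →ₐ[F] Λ') :
    ExtCat F C Λ ⥤ ExtCat F C Λ' where
  obj X := ⟨X.obj⟩
  map {X Y} x := TensorProduct.map φ.toLinearMap (LinearMap.id : (X.obj ⟶ Y.obj) →ₗ[F] _) x
  map_id X := by
    change TensorProduct.map φ.toLinearMap LinearMap.id ((1 : Λ) ⊗ₜ 𝟙 X.obj) = (1 : Λ') ⊗ₜ 𝟙 X.obj
    simp
  map_comp {X Y Z} x y := by
    change TensorProduct.map φ.toLinearMap LinearMap.id (ExtCat.compMap F Λ _ _ _ x y) =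
      ExtCat.compMap F Λ' _ _ _ (TensorProduct.map φ.toLinearMap LinearMap.id x)
        (TensorProduct.map φ.toLinearMap LinearMap.id y)
    exact ExtCat.map_compMap φ x y

end ExtCat

/-! ### Actions of abstract groups on categories -/

/-- An action of an abstract group `G` on a category `D`: functors `q · -`, a natural isomorphism
`1 · - ≅ id`, natural isomorphisms `q₂ · (q₁ · -) ≅ (q₂ q₁) · -`, and the usual three coherence
conditions. The unit is given as an `e` with a proof of `e = 1` and the product as a `q` with a proof
of `q₂ * q₁ = q`; this is the same data, and the identifications such as `(1 q) · - = q · -` in the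
coherence conditions need no transport. -/
structure CatAction (G : Type*) [Group G] (D : Type*) [Category D] where
  /-- The functor `q · -`. -/
  act : G → D ⥤ D
  /-- The isomorphism `1 · - ≅ id`. -/
  unit {e : G} (he : e = 1) : act e ≅ 𝟭 D
  /-- The isomorphism `q₂ · (q₁ · -) ≅ (q₂ q₁) · -`. -/
  mul {q₁ q₂ q : G} (h : q₂ * q₁ = q) : act q₁ ⋙ act q₂ ≅ act q
  unit_left {e q : G} (he : e = 1) (h : e * q = q) (X : D) :
    (mul h).hom.app X = (unit he).hom.app ((act q).obj X)
  unit_right {e q : G} (he : e = 1) (h : q * e = q) (X : D) :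
    (mul h).hom.app X = (act q).map ((unit he).hom.app X)
  assoc {q₁ q₂ q₃ q₂₁ q₃₂ q₃₂₁ : G} (h₂₁ : q₂ * q₁ = q₂₁) (h₃₂ : q₃ * q₂ = q₃₂)
    (h : q₃ * q₂₁ = q₃₂₁) (h' : q₃₂ * q₁ = q₃₂₁) (X : D) :
    (act q₃).map ((mul h₂₁).hom.app X) ≫ (mul h).hom.app X =
      (mul h₃₂).hom.app ((act q₁).obj X) ≫ (mul h').hom.app X

/-- The action deduced from a group homomorphism. -/
def CatAction.res {G₁ G₂ : Type*} [Group G₁] [Group G₂] (f : G₁ →* G₂) {D : Type*} [Category D]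
    (A : CatAction G₂ D) : CatAction G₁ D where
  act q := A.act (f q)
  unit he := A.unit (by rw [he, map_one])
  mul h := A.mul (by rw [← h, map_mul])
  unit_left _ _ X := A.unit_left _ _ X
  unit_right _ _ X := A.unit_right _ _ X
  assoc _ _ _ _ X := A.assoc _ _ _ _ X

/-- The structure `α` of an equivariant object `(X, α)` on an object `X`, for an action of an
abstract group: isomorphisms `α q : q · X ≅ X`, where `α 1` is the canonical one, which satisfy the
cocycle condition. -/
@[ext]
structure CatAction.EquivStr {G : Type*} [Group G] {D : Type*} [Category D] (A : CatAction G D)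
    (X : D) where
  /-- The isomorphism `q · X ≅ X`. -/
  α (q : G) : (A.act q).obj X ≅ X
  α_unit {e : G} (he : e = 1) : (α e).hom = (A.unit he).hom.app X
  cocycle {q₁ q₂ q : G} (h : q₂ * q₁ = q) :
    (A.act q₂).map (α q₁).hom ≫ (α q₂).hom = (A.mul h).hom.app X ≫ (α q).hom

/-! ### Algebraic actions and their equivariant objects -/

section Algebraic

variable {F : Type u} [Field F]

/-- An `F`-algebraic action of `Q` on the `F`-linear category `C`: a `Λ`-linear action of `Q(Λ)` on
`C_Λ` for every commutative `F`-algebra `Λ`, functorial in `Λ`. That the squares formed by `q · -`,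
`φ(q) · -` and the transition functors commute is understood, as everywhere for functors, up to
given natural isomorphisms `base`, which are compatible with identities and composites of algebra
homomorphisms and with the structure isomorphisms of the actions. Strictly commuting squares are the
case where they are identities. -/
structure AlgAction (Q : ProAlgGrp F) (C : Type w) [Category.{v} C] [Preadditive C]
    [Linear F C] where
  /-- The action of `Q(Λ)` on `C_Λ`. -/
  action (Λ : Type u) [CommRing Λ] [Algebra F Λ] : CatAction (Pts Q Λ) (ExtCat F C Λ)
  additive (Λ : Type u) [CommRing Λ] [Algebra F Λ] (q : Pts Q Λ) :
    ((action Λ).act q).Additive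
  linear (Λ : Type u) [CommRing Λ] [Algebra F Λ] (q : Pts Q Λ) :
    ((action Λ).act q).Linear Λ
  /-- The square for `φ : Λ → Λ'` and `q ∈ Q(Λ)`, where `q' = φ(q)`. -/
  base {Λ Λ' : Type u} [CommRing Λ] [Algebra F Λ] [CommRing Λ'] [Algebra F Λ'] (φ : Λ →ₐ[F] Λ')
    {q : Pts Q Λ} {q' : Pts Q Λ'} (h : Pts.map Q φ q = q') :
    (action Λ).act q ⋙ ExtCat.trans C φ ≅ ExtCat.trans C φ ⋙ (action Λ').act q'
  base_id {Λ : Type u} [CommRing Λ] [Algebra F Λ] {q : Pts Q Λ}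
    (h : Pts.map Q (AlgHom.id F Λ) q = q) (X : ExtCat F C Λ) :
    (base (AlgHom.id F Λ) h).hom.app X = 𝟙 (((action Λ).act q).obj X)
  base_comp {Λ Λ' Λ'' : Type u} [CommRing Λ] [Algebra F Λ] [CommRing Λ'] [Algebra F Λ']
    [CommRing Λ''] [Algebra F Λ''] (φ : Λ →ₐ[F] Λ') (ψ : Λ' →ₐ[F] Λ'')
    {q : Pts Q Λ} {q' : Pts Q Λ'} {q'' : Pts Q Λ''} (h : Pts.map Q φ q = q')
    (h' : Pts.map Q ψ q' = q'') (h'' : Pts.map Q (ψ.comp φ) q = q'') (X : ExtCat F C Λ) :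
    (base (ψ.comp φ) h'').hom.app X =
      (ExtCat.trans C ψ).map ((base φ h).hom.app X) ≫
        (base ψ h').hom.app ((ExtCat.trans C φ).obj X)
  base_unit {Λ Λ' : Type u} [CommRing Λ] [Algebra F Λ] [CommRing Λ'] [Algebra F Λ']
    (φ : Λ →ₐ[F] Λ') {e : Pts Q Λ} {e' : Pts Q Λ'} (h : Pts.map Q φ e = e') (he : e = 1)
    (he' : e' = 1) (X : ExtCat F C Λ) :
    (ExtCat.trans C φ).map (((action Λ).unit he).hom.app X) =
      (base φ h).hom.app X ≫ ((action Λ').unit he').hom.app ((ExtCat.trans C φ).obj X)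
  base_mul {Λ Λ' : Type u} [CommRing Λ] [Algebra F Λ] [CommRing Λ'] [Algebra F Λ']
    (φ : Λ →ₐ[F] Λ') {q₁ q₂ q : Pts Q Λ} {q₁' q₂' q' : Pts Q Λ'} (h₁ : Pts.map Q φ q₁ = q₁')
    (h₂ : Pts.map Q φ q₂ = q₂') (h : Pts.map Q φ q = q') (hq : q₂ * q₁ = q)
    (hq' : q₂' * q₁' = q') (X : ExtCat F C Λ) :
    (ExtCat.trans C φ).map (((action Λ).mul hq).hom.app X) ≫ (base φ h).hom.app X =
      (base φ h₂).hom.app (((action Λ).act q₁).obj X) ≫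
        ((action Λ').act q₂').map ((base φ h₁).hom.app X) ≫
          ((action Λ').mul hq').hom.app ((ExtCat.trans C φ).obj X)

variable {Q Q₁ Q₂ : ProAlgGrp F} {C : Type w} [Category.{v} C] [Preadditive C] [Linear F C]

/-- The algebraic action of `Q₁` deduced from one of `Q₂` via a morphism `f : Q₁ ⟶ Q₂`. -/
def AlgAction.res (f : Q₁ ⟶ Q₂) (A : AlgAction Q₂ C) : AlgAction Q₁ C where
  action Λ _ _ := (A.action Λ).res (Pts.push f Λ)
  additive Λ _ _ q := A.additive Λ (Pts.push f Λ q)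
  linear Λ _ _ q := A.linear Λ (Pts.push f Λ q)
  base φ _ _ h := A.base φ (by rw [Pts.map_push, h])
  base_id _ X := A.base_id _ X
  base_comp φ ψ _ _ _ _ _ _ X := A.base_comp φ ψ _ _ _ X
  base_unit φ _ _ _ _ _ X := A.base_unit φ _ _ _ X
  base_mul φ _ _ _ _ _ _ _ _ _ _ _ X := A.base_mul φ _ _ _ _ _ X

/-- An `F`-algebraic equivariant object `(C, α)`: an object of `C` with the structure of an
equivariant object on its image in `C_Λ` for every `Λ`, such that `α_{Λ, q} ⊗ 1` corresponds to
`α_{Λ', φ(q)}` for every `φ : Λ → Λ'`. -/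
structure EquivObj (A : AlgAction Q C) where
  /-- The underlying object of `C`. -/
  obj : C
  /-- The isomorphisms `α_{Λ, q}`. -/
  str (Λ : Type u) [CommRing Λ] [Algebra F Λ] : (A.action Λ).EquivStr ⟨obj⟩
  str_base {Λ Λ' : Type u} [CommRing Λ] [Algebra F Λ] [CommRing Λ'] [Algebra F Λ']
    (φ : Λ →ₐ[F] Λ') {q : Pts Q Λ} {q' : Pts Q Λ'} (h : Pts.map Q φ q = q') :
    (ExtCat.trans C φ).map ((str Λ).α q).hom =
      (A.base φ h).hom.app ⟨obj⟩ ≫ ((str Λ').α q').hom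

/-- A morphism of equivariant objects: a morphism of `C` that commutes with all `α_{Λ, q}`. -/
@[ext]
structure EquivObj.Hom {A : AlgAction Q C} (X Y : EquivObj A) where
  /-- The underlying morphism of `C`. -/
  hom : X.obj ⟶ Y.obj
  comm (Λ : Type u) [CommRing Λ] [Algebra F Λ] (q : Pts Q Λ) :
    ((A.action Λ).act q).map (ExtCat.incl F Λ hom) ≫ ((Y.str Λ).α q).hom =
      ((X.str Λ).α q).hom ≫ ExtCat.incl F Λ hom

/-- The category of `F`-algebraic equivariant objects. -/
instance EquivObj.category (A : AlgAction Q C) : Category (EquivObj A) where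
  Hom X Y := EquivObj.Hom X Y
  id X := ⟨𝟙 X.obj, fun Λ _ _ q => by
    rw [ExtCat.incl_id, CategoryTheory.Functor.map_id, Category.id_comp, Category.comp_id]⟩
  comp x y := ⟨x.hom ≫ y.hom, fun Λ _ _ q => by
    rw [ExtCat.incl_comp, Functor.map_comp, Category.assoc, y.comm, ← Category.assoc, x.comm,
      Category.assoc]⟩
  id_comp x := EquivObj.Hom.ext (Category.id_comp x.hom)
  comp_id x := EquivObj.Hom.ext (Category.comp_id x.hom)
  assoc x y z := EquivObj.Hom.ext (Category.assoc x.hom y.hom z.hom)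

/-- The restriction functor along `f : Q₁ ⟶ Q₂`, which sends `(C, α)` to `(C, α^f)` with
`α^f_{Λ, q} = α_{Λ, f(q)}` and is the identity on underlying morphisms of `C`. -/
def resFunctor (f : Q₁ ⟶ Q₂) (A : AlgAction Q₂ C) : EquivObj A ⥤ EquivObj (A.res f) where
  obj X :=
    { obj := X.obj
      str := fun Λ _ _ =>
        { α := fun q => (X.str Λ).α (Pts.push f Λ q)
          α_unit := fun he => (X.str Λ).α_unit (by rw [he, map_one])
          cocycle := fun h => (X.str Λ).cocycle (by rw [← h, map_mul]) }
      str_base := fun φ _ _ h => X.str_base φ (by rw [Pts.map_push, h]) }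
  map x := ⟨x.hom, fun Λ _ _ q => x.comm Λ (Pts.push f Λ q)⟩
  map_id _ := rfl
  map_comp _ _ := rfl

end Algebraic

end ProAlg

end

noncomputable section

namespace ProAlg

open Coalgebra Bialgebra

/-! ### The semidirect product of an affine group scheme and a vector group -/

/-! Faithfulness is immediate, since `res` does not change underlying morphisms. For conservativity,
the inverse in `C` of an equivariant morphism is again equivariant.

For fullness, let `g : X ⟶ Y` commute with the action of `Q₁`. The group `Q₂` acts on morphisms by
conjugation with the `α`'s, and `g` is to be shown fixed. Conjugating `g` by the universal point of
`Q₂` gives an element `ρ` of `O(Q₂) ⊗ Hom(X, Y)` that determines the conjugate of `g` by every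
point, so the claim is `ρ = 1 ⊗ g`. For a linear form `l` on `Hom(X, Y)`, contracting `ρ` gives the
function `h(q) = l(q · g)` on `Q₂`. It satisfies `h(q f(q₁)) = h(q)`, because `g` is fixed by `Q₁`.
If `h` is constant, it equals `h(1) = l(g)`, and linear forms separate tensors over a field.

Constancy is `eq_algebraMap_of_mono`. Since `h` lies in a finite-dimensional translation-stable
space `V`, it suffices that a vector of `V` fixed by `Q₁` is fixed by `Q₂` (`fixed_of_mono`). This
uses only the categorical definition of an epimorphism: for such a vector `v`, the homomorphisms `q
↦ (v - qv, q)` and `q ↦ (0, q)` from `Q₂` to the semidirect product of `V` and `Q₂` agree after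
composition with `f`, hence agree, so `qv = v`. -/

/-- A square matrix `c` with entries in the algebra of functions of an affine group scheme is a
comatrix if it is the matrix of a linear representation. -/
structure IsComatrix (F : Type*) {H ι : Type*} [Field F] [CommRing H] [HopfAlgebra F H]
    [Fintype ι] [DecidableEq ι] (c : ι → ι → H) : Prop where
  comul (i k : ι) : comul (R := F) (c i k) = ∑ j, c i j ⊗ₜ c j k
  counit (i k : ι) : counit (R := F) (c i k) = if i = k then 1 else 0

/-- The algebra of functions of the product of an affine group scheme, with functions `H`, and the
affine space with coordinates indexed by `ι`. -/
def AffineExt (H ι : Type*) [CommRing H] : Type _ := MvPolynomial ι H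

namespace AffineExt

variable {F H ι : Type*} [Field F] [CommRing H]

instance : CommRing (AffineExt H ι) := inferInstanceAs (CommRing (MvPolynomial ι H))

instance [Algebra F H] : Algebra F (AffineExt H ι) := inferInstanceAs (Algebra F (MvPolynomial ι H))

/-- The inclusion of the functions on the group. -/
def incl (F : Type*) {H : Type*} (ι : Type*) [Field F] [CommRing H] [Algebra F H] :
    H →ₐ[F] AffineExt H ι :=
  IsScalarTower.toAlgHom F H (MvPolynomial ι H)

/-- The coordinate functions on the affine space. -/
def X (i : ι) : AffineExt H ι := MvPolynomial.X i

/-- The homomorphism from the algebra of functions with given values on `H` and on the coordinate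
functions. -/
def lift [Algebra F H] {B : Type*} [CommRing B] [Algebra F B] (φ : H →ₐ[F] B) (t : ι → B) :
    AffineExt H ι →ₐ[F] B :=
  { MvPolynomial.eval₂Hom φ.toRingHom t with
    commutes' := fun r => by
      change MvPolynomial.eval₂Hom φ.toRingHom t (algebraMap F (MvPolynomial ι H) r) = _
      rw [IsScalarTower.algebraMap_apply F H (MvPolynomial ι H), MvPolynomial.algebraMap_eq,
        MvPolynomial.eval₂Hom_C]
      exact φ.commutes r }

section

variable [Algebra F H] {B : Type*} [CommRing B] [Algebra F B]

@[simp]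
theorem lift_incl (φ : H →ₐ[F] B) (t : ι → B) (x : H) : lift φ t (incl F ι x) = φ x :=
  MvPolynomial.eval₂Hom_C φ.toRingHom t x

@[simp]
theorem lift_X (φ : H →ₐ[F] B) (t : ι → B) (i : ι) : lift φ t (X i) = t i :=
  MvPolynomial.eval₂Hom_X' φ.toRingHom t i

theorem hom_ext {φ ψ : AffineExt H ι →ₐ[F] B} (h : φ.comp (incl F ι) = ψ.comp (incl F ι))
    (hX : ∀ i, φ (X i) = ψ (X i)) : φ = ψ :=
  MvPolynomial.algHom_ext' h hX

end

variable [HopfAlgebra F H] [Fintype ι]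

/-- The comultiplication of the semidirect product. -/
def comulHom (F : Type*) {H ι : Type*} [Field F] [CommRing H] [HopfAlgebra F H] [Fintype ι]
    (c : ι → ι → H) : AffineExt H ι →ₐ[F] AffineExt H ι ⊗[F] AffineExt H ι :=
  lift ((Algebra.TensorProduct.map (incl (H := H) F ι) (incl (H := H) F ι)).comp (comulAlgHom F H))
    -- The group law `(t, q)(t', q') = (t + qt', qq')`, where `q` acts through `c`.
    fun i => X i ⊗ₜ 1 + ∑ j, incl F ι (c i j) ⊗ₜ X j

/-- The counit of the semidirect product. -/
def counitHom (F H ι : Type*) [Field F] [CommRing H] [HopfAlgebra F H] : AffineExt H ι →ₐ[F] F :=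
  lift (counitAlgHom F H) 0

/-- The antipode of the semidirect product. -/
def antipodeHom (F : Type*) {H ι : Type*} [Field F] [CommRing H] [HopfAlgebra F H] [Fintype ι]
    (c : ι → ι → H) : AffineExt H ι →ₐ[F] AffineExt H ι :=
  lift ((incl F ι).comp (HopfAlgebra.antipodeAlgHom F H))
    -- The inverse `(t, q)⁻¹ = (-q⁻¹t, q⁻¹)`.
    fun i => -∑ j, incl F ι (HopfAlgebra.antipode F (c i j)) * X j

theorem comulHom_incl (c : ι → ι → H) (x : H) : comulHom F c (incl F ι x) =
    Algebra.TensorProduct.map (incl (H := H) F ι) (incl (H := H) F ι) (comul (R := F) x) :=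
  lift_incl _ _ x

theorem comulHom_X (c : ι → ι → H) (i : ι) :
    comulHom F c (X i) = X i ⊗ₜ 1 + ∑ j, incl F ι (c i j) ⊗ₜ X j :=
  lift_X _ _ i

theorem counitHom_lTensor (c : ι → ι → H) :
    (Algebra.TensorProduct.map (.id F _) (counitHom F H ι)).comp (comulHom F c) =
      (Algebra.TensorProduct.rid F F (AffineExt H ι)).symm := by
  apply hom_ext
  -- Stated for an arbitrary tensor, so that it applies to the coproduct of an element of `H` and
  -- reduces the axiom on `H` to the one known there. The later axioms are treated in the same way.
  · have h (x : H ⊗[F] H) : Algebra.TensorProduct.map (.id F _) (counitHom F H ι)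
          (Algebra.TensorProduct.map (incl (H := H) F ι) (incl (H := H) F ι) x) =
        Algebra.TensorProduct.map (incl (H := H) F ι) (.id F F) ((counit (R := F)).lTensor H x) := by
      induction x with
      | zero => simp
      | add x y hx hy => simp only [map_add, hx, hy]
      | tmul a b => simp [counitHom]
    ext x
    change Algebra.TensorProduct.map (.id F _) (counitHom F H ι) (comulHom F c (incl F ι x)) =
      incl F ι x ⊗ₜ 1
    rw [comulHom_incl, h, lTensor_counit_comul]
    simp
  · intro i
    change Algebra.TensorProduct.map (.id F _) (counitHom F H ι) (comulHom F c (X i)) = X i ⊗ₜ 1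
    simp [comulHom_X, counitHom]

theorem antipodeHom_left (c : ι → ι → H) :
    (Algebra.TensorProduct.lift (antipodeHom F c) (.id F _) fun _ ↦ Commute.all _).comp
      (comulHom F c) = (Algebra.ofId F _).comp (counitHom F H ι) := by
  apply hom_ext
  · have h (x : H ⊗[F] H) :
        (Algebra.TensorProduct.lift (antipodeHom F c) (.id F _) fun _ ↦ Commute.all _)
          (Algebra.TensorProduct.map (incl (H := H) F ι) (incl (H := H) F ι) x) =
        incl F ι (LinearMap.mul' F H ((HopfAlgebra.antipode F).rTensor H x)) := by
      induction x with
      | zero => simp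
      | add x y hx hy => simp only [map_add, hx, hy]
      | tmul a b => simp [antipodeHom]
    ext x
    change (Algebra.TensorProduct.lift (antipodeHom F c) (.id F _) fun _ ↦ Commute.all _)
      (comulHom F c (incl F ι x)) = algebraMap F _ (counitHom F H ι (incl F ι x))
    rw [comulHom_incl, h, HopfAlgebra.mul_antipode_rTensor_comul_apply, AlgHom.commutes]
    simp [counitHom]
  · intro i
    change (Algebra.TensorProduct.lift (antipodeHom F c) (.id F _) fun _ ↦ Commute.all _)
      (comulHom F c (X i)) = algebraMap F _ (counitHom F H ι (X i))
    simp [comulHom_X, counitHom, antipodeHom]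

variable [DecidableEq ι] {c : ι → ι → H}

/-- On the coordinates, associativity amounts to `q(q't) = (qq')t`, which is the comultiplication
rule of a comatrix. -/
theorem comulHom_coassoc (hc : IsComatrix F c) :
    (Algebra.TensorProduct.assoc F F F (AffineExt H ι) (AffineExt H ι) (AffineExt H ι)).toAlgHom.comp
      ((Algebra.TensorProduct.map (comulHom F c) (.id F _)).comp (comulHom F c)) =
    (Algebra.TensorProduct.map (.id F _) (comulHom F c)).comp (comulHom F c) := by
  apply hom_ext
  · have h (x : H ⊗[F] H) : (Algebra.TensorProduct.assoc F F F (AffineExt H ι) (AffineExt H ι)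
          (AffineExt H ι)) (Algebra.TensorProduct.map (comulHom F c) (.id F _)
            (Algebra.TensorProduct.map (incl (H := H) F ι) (incl (H := H) F ι) x)) =
        Algebra.TensorProduct.map (incl F ι) (Algebra.TensorProduct.map (incl (H := H) F ι) (incl (H := H) F ι))
          (TensorProduct.assoc F H H H ((comul (R := F)).rTensor H x)) := by
      induction x with
      | zero => simp
      | add x y hx hy => simp only [map_add, hx, hy]
      | tmul a b =>
        simp only [Algebra.TensorProduct.map_tmul, comulHom_incl, LinearMap.rTensor_tmul,
          AlgHom.id_apply]
        induction comul (R := F) a with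
        | zero => simp
        | add x y hx hy => simp only [map_add, TensorProduct.add_tmul, hx, hy]
        | tmul a a' => simp
    have h' (x : H ⊗[F] H) : Algebra.TensorProduct.map (.id F _) (comulHom F c)
            (Algebra.TensorProduct.map (incl (H := H) F ι) (incl (H := H) F ι) x) =
        Algebra.TensorProduct.map (incl F ι) (Algebra.TensorProduct.map (incl (H := H) F ι) (incl (H := H) F ι))
          ((comul (R := F)).lTensor H x) := by
      induction x with
      | zero => simp
      | add x y hx hy => simp only [map_add, hx, hy]
      | tmul a b => simp [comulHom_incl]
    ext x
    change (Algebra.TensorProduct.assoc F F F (AffineExt H ι) (AffineExt H ι)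
          (AffineExt H ι)) (Algebra.TensorProduct.map (comulHom F c) (.id F _)
            (comulHom F c (incl F ι x))) = Algebra.TensorProduct.map (.id F _) (comulHom F c)
            (comulHom F c (incl F ι x))
    rw [comulHom_incl, h, h', coassoc_apply]
  · intro i
    change (Algebra.TensorProduct.assoc F F F (AffineExt H ι) (AffineExt H ι)
          (AffineExt H ι)) (Algebra.TensorProduct.map (comulHom F c) (.id F _)
            (comulHom F c (X i))) = Algebra.TensorProduct.map (.id F _) (comulHom F c)
            (comulHom F c (X i))
    simp only [comulHom_X, comulHom_incl, hc.comul, map_add, map_sum,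
      Algebra.TensorProduct.map_tmul, AlgHom.id_apply, map_one, TensorProduct.add_tmul,
      TensorProduct.sum_tmul, TensorProduct.tmul_add, TensorProduct.tmul_sum,
      Algebra.TensorProduct.assoc_tmul, Algebra.TensorProduct.one_def, add_assoc,
      Finset.sum_add_distrib]
    congr 2
    exact Finset.sum_comm

theorem counitHom_rTensor (hc : IsComatrix F c) :
    (Algebra.TensorProduct.map (counitHom F H ι) (.id F _)).comp (comulHom F c) =
      (Algebra.TensorProduct.lid F (AffineExt H ι)).symm := by
  apply hom_ext
  · have h (x : H ⊗[F] H) : Algebra.TensorProduct.map (counitHom F H ι) (.id F _)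
          (Algebra.TensorProduct.map (incl (H := H) F ι) (incl (H := H) F ι) x) =
        Algebra.TensorProduct.map (.id F F) (incl (H := H) F ι) ((counit (R := F)).rTensor H x) := by
      induction x with
      | zero => simp
      | add x y hx hy => simp only [map_add, hx, hy]
      | tmul a b => simp [counitHom]
    ext x
    change Algebra.TensorProduct.map (counitHom F H ι) (.id F _) (comulHom F c (incl F ι x)) =
      1 ⊗ₜ incl F ι x
    rw [comulHom_incl, h, rTensor_counit_comul]
    simp
  · intro i
    change Algebra.TensorProduct.map (counitHom F H ι) (.id F _) (comulHom F c (X i)) = 1 ⊗ₜ X i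
    simp [comulHom_X, counitHom, hc.counit, TensorProduct.ite_tmul]

/-- The bialgebra of functions of the semidirect product. -/
abbrev bialgebra (hc : IsComatrix F c) : Bialgebra F (AffineExt H ι) :=
  .ofAlgHom (comulHom F c) (counitHom F H ι) (comulHom_coassoc hc) (counitHom_rTensor hc)
    (counitHom_lTensor c)

/-- The antipode axiom applied to a matrix coefficient: `q` and `q⁻¹` act by inverse matrices. -/
theorem sum_mul_antipode (hc : IsComatrix F c) (i k : ι) :
    ∑ j, c i j * HopfAlgebra.antipode F (c j k) = if i = k then 1 else 0 := by
  have h := HopfAlgebra.mul_antipode_lTensor_comul_apply (R := F) (c i k)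
  rw [hc.comul, hc.counit] at h
  simpa [apply_ite] using h

theorem antipodeHom_right (hc : IsComatrix F c) :
    (Algebra.TensorProduct.lift (.id F _) (antipodeHom F c) fun _ _ ↦ Commute.all _ _).comp
      (comulHom F c) = (Algebra.ofId F _).comp (counitHom F H ι) := by
  apply hom_ext
  · have h (x : H ⊗[F] H) :
        (Algebra.TensorProduct.lift (.id F _) (antipodeHom F c) fun _ _ ↦ Commute.all _ _)
          (Algebra.TensorProduct.map (incl (H := H) F ι) (incl (H := H) F ι) x) =
        incl F ι (LinearMap.mul' F H ((HopfAlgebra.antipode F).lTensor H x)) := by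
      induction x with
      | zero => simp
      | add x y hx hy => simp only [map_add, hx, hy]
      | tmul a b => simp [antipodeHom]
    ext x
    change (Algebra.TensorProduct.lift (.id F _) (antipodeHom F c) fun _ _ ↦ Commute.all _ _)
      (comulHom F c (incl F ι x)) = algebraMap F _ (counitHom F H ι (incl F ι x))
    rw [comulHom_incl, h, HopfAlgebra.mul_antipode_lTensor_comul_apply, AlgHom.commutes]
    simp [counitHom]
  · intro i
    change (Algebra.TensorProduct.lift (.id F _) (antipodeHom F c) fun _ _ ↦ Commute.all _ _)
      (comulHom F c (X i)) = algebraMap F _ (counitHom F H ι (X i))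
    have h : ∑ j, incl F ι (c i j) * ∑ k, incl F ι (HopfAlgebra.antipode F (c j k)) * X k =
        (X i : AffineExt H ι) := by
      simp_rw [Finset.mul_sum, ← mul_assoc, ← map_mul]
      rw [Finset.sum_comm]
      simp_rw [← Finset.sum_mul, ← map_sum, sum_mul_antipode hc]
      simp [apply_ite]
    simp [comulHom_X, counitHom, antipodeHom, h]

/-- The Hopf algebra of functions of the semidirect product. -/
abbrev hopfAlgebra (hc : IsComatrix F c) : HopfAlgebra F (AffineExt H ι) :=
  letI := bialgebra hc
  .ofAlgHom (antipodeHom F c) (antipodeHom_left c) (antipodeHom_right hc)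

/-- The homomorphism of Hopf algebras which corresponds to the homomorphism from a group to the
semidirect product that is given by a crossed homomorphism `d`. -/
def crossedHom (hc : IsComatrix F c) (d : ι → H)
    (hd : ∀ i, comul (R := F) (d i) = d i ⊗ₜ 1 + ∑ j, c i j ⊗ₜ d j)
    (hd' : ∀ i, counit (R := F) (d i) = 0) :
    letI := hopfAlgebra hc
    AffineExt H ι →ₐc[F] H :=
  letI := hopfAlgebra hc
  .ofAlgHom (lift (.id F H) d)
    (by
      apply hom_ext
      · ext x
        change counit (R := F) (lift (.id F H) d (incl F ι x)) = counitHom F H ι (incl F ι x)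
        simp [counitHom]
      · intro i
        change counit (R := F) (lift (.id F H) d (X i)) = counitHom F H ι (X i)
        simp [counitHom, hd'])
    (by
      apply hom_ext
      · have h (x : H ⊗[F] H) : Algebra.TensorProduct.map (lift (.id F H) d) (lift (.id F H) d)
            (Algebra.TensorProduct.map (incl (H := H) F ι) (incl (H := H) F ι) x) = x := by
          induction x with
          | zero => simp
          | add x y hx hy => simp only [map_add, hx, hy]
          | tmul a b => simp
        ext x
        change Algebra.TensorProduct.map (lift (.id F H) d) (lift (.id F H) d)
          (comulHom F c (incl F ι x)) = comul (R := F) (lift (.id F H) d (incl F ι x))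
        rw [comulHom_incl, h]
        simp
      · intro i
        change Algebra.TensorProduct.map (lift (.id F H) d) (lift (.id F H) d)
          (comulHom F c (X i)) = comul (R := F) (lift (.id F H) d (X i))
        simp [comulHom_X, hd])

end AffineExt

/-- A vector of a linear representation that is fixed under an epimorphism to the group is fixed
under the group. -/
theorem fixed_of_mono {F : Type u} [Field F] {H H' : CommHopfAlgCat.{u} F} (f : H ⟶ H')
    [Mono f] {n : ℕ} {c : Fin n → Fin n → H} (hc : IsComatrix F c) (v : Fin n → F)
    (hv : ∀ i, f.hom (∑ j, v j • c i j) = algebraMap F H' (v i)) (i : Fin n) :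
    ∑ j, v j • c i j = algebraMap F H (v i) := by
  -- The coboundary `d(q) = v - qv`, a crossed homomorphism because `v - qq'v = (v - qv) + q(v -
  -- q'v)`.
  let d (i : Fin n) : H := algebraMap F H (v i) - ∑ j, v j • c i j
  have hd (i : Fin n) : comul (R := F) (d i) = d i ⊗ₜ 1 + ∑ j, c i j ⊗ₜ d j := by
    simp only [d, map_sub, map_sum, map_smul, hc.comul, comul_one, TensorProduct.sub_tmul,
      TensorProduct.tmul_sub, Finset.sum_sub_distrib, TensorProduct.sum_tmul,
      TensorProduct.tmul_sum, Finset.smul_sum, TensorProduct.tmul_smul,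
      Algebra.algebraMap_eq_smul_one, ← TensorProduct.smul_tmul', Algebra.TensorProduct.one_def]
    rw [Finset.sum_comm (γ := Fin n)]
    abel
  have hd' (i : Fin n) : counit (R := F) (d i) = 0 := by
    simp [d, hc.counit]
  let := AffineExt.hopfAlgebra hc
  let φ : CommHopfAlgCat.of F (AffineExt H (Fin n)) ⟶ H :=
    CommHopfAlgCat.ofHom (AffineExt.crossedHom hc d hd hd')
  let ψ : CommHopfAlgCat.of F (AffineExt H (Fin n)) ⟶ H :=
    CommHopfAlgCat.ofHom (AffineExt.crossedHom hc 0 (by simp) (by simp))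
  -- `φ` and `ψ` correspond to `q ↦ (d(q), q)` and `q ↦ (0, q)`; they agree after `f` because `hv`
  -- says that `f` kills `d`.
  have hφψ : φ ≫ f = ψ ≫ f := by
    have h : (f.hom : H →ₐ[F] H').comp (AffineExt.lift (.id F H) d) =
        (f.hom : H →ₐ[F] H').comp (AffineExt.lift (.id F H) 0) := by
      apply AffineExt.hom_ext
      · ext x
        simp
      · intro i
        have := hv i
        simp only [AlgHom.comp_apply, AffineExt.lift_X, d, Pi.zero_apply, map_zero]
        rw [map_sub, sub_eq_zero, AlgHom.commutes]
        exact this.symm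
    ext x
    exact DFunLike.congr_fun h x
  have h := (cancel_mono f).1 hφψ
  have hi : φ.hom (AffineExt.X i) = ψ.hom (AffineExt.X i) := by rw [h]
  change AffineExt.lift (.id F H) d (AffineExt.X i) =
    AffineExt.lift (.id F H) 0 (AffineExt.X i) at hi
  rw [AffineExt.lift_X, AffineExt.lift_X, Pi.zero_apply, sub_eq_zero] at hi
  exact hi.symm

end ProAlg

end

noncomputable section

namespace ProAlg

open Coalgebra

/-! ### Comatrices and translates of functions -/

section Slice

variable {F M N : Type*} [Field F] [AddCommGroup M] [Module F M] [AddCommGroup N] [Module F N]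

/-- Contraction of the second factor of a tensor product with a linear form. -/
def slice (F M : Type*) {N : Type*} [Field F] [AddCommGroup M] [Module F M] [AddCommGroup N]
    [Module F N] (l : N →ₗ[F] F) : M ⊗[F] N →ₗ[F] M :=
  (TensorProduct.rid F M).toLinearMap ∘ₗ l.lTensor M

@[simp]
theorem slice_tmul (l : N →ₗ[F] F) (x : M) (y : N) : slice F M l (x ⊗ₜ y) = l y • x := by
  simp [slice]

/-- The coordinate forms of a basis of `N`, which may be infinite, already determine a tensor. -/
theorem eq_of_forall_slice_eq {x y : M ⊗[F] N} (h : ∀ l : N →ₗ[F] F, slice F M l x = slice F M l y) :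
    x = y := by
  let b := Module.Basis.ofVectorSpace F N
  classical
  apply (TensorProduct.equivFinsuppOfBasisRight (M := M) b).injective
  ext i
  rw [TensorProduct.equivFinsuppOfBasisRight_apply, TensorProduct.equivFinsuppOfBasisRight_apply]
  exact h (b.coord i)

/-- A left inverse of the linear combination map of `a` extracts the coefficients. This is what
allows coefficients of independent vectors to be compared below. -/
theorem sum_tmul_injective {ι : Type*} [Fintype ι] {a : ι → M} (ha : LinearIndependent F a)
    {x y : ι → N} (h : ∑ i, a i ⊗ₜ[F] x i = ∑ i, a i ⊗ₜ[F] y i) : x = y := by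
  classical
  obtain ⟨g, hg⟩ := (Finsupp.linearCombination F a).exists_leftInverse_of_injective
    (LinearMap.ker_eq_bot.2 ha)
  have hga (i : ι) : g (a i) = Finsupp.single i 1 := by
    simpa using LinearMap.congr_fun hg (Finsupp.single i 1)
  ext k
  have := congrArg (fun z => TensorProduct.lid F N ((Finsupp.lapply k ∘ₗ g).rTensor N z)) h
  simpa [hga, Finsupp.single_apply] using this

/-- The linear forms on the second factor contract a tensor to a finite-dimensional space, over
which the tensor is defined. -/
theorem exists_slice_basis (x : M ⊗[F] N) :
    ∃ (n : ℕ) (a : Fin n → M) (b : Fin n → N) (l : Fin n → (N →ₗ[F] F)), LinearIndependent F a ∧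
      x = ∑ i, a i ⊗ₜ b i ∧ ∀ i, a i = slice F M (l i) x := by
  classical
  let e := Module.Basis.ofVectorSpace F N
  let s := TensorProduct.equivFinsuppOfBasisRight (M := M) e x
  have hs (k) : s k = slice F M (e.coord k) x := TensorProduct.equivFinsuppOfBasisRight_apply ..
  have hx : x = ∑ k ∈ s.support, s k ⊗ₜ e k := by
    have := TensorProduct.equivFinsuppOfBasisRight_symm_apply (M := M) e s
    rwa [LinearEquiv.symm_apply_apply] at this
  let sl : (N →ₗ[F] F) →ₗ[F] M :=
    { toFun l := slice F M l x
      map_add' l l' := by simp [slice, LinearMap.lTensor_add]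
      map_smul' r l := by simp [slice, LinearMap.lTensor_smul] }
  -- In a basis of `N` only finitely many coefficients of `x` are nonzero, and every contraction is
  -- a combination of these.
  have hfin : sl.range ≤ Submodule.span F (s.support.image s : Set M) := by
    rintro _ ⟨l, rfl⟩
    change slice F M l x ∈ _
    rw [hx, map_sum]
    refine Submodule.sum_mem _ fun k hk => ?_
    rw [slice_tmul]
    exact Submodule.smul_mem _ _
      (Submodule.subset_span (Finset.mem_coe.2 (Finset.mem_image_of_mem s hk)))
  have : FiniteDimensional F sl.range := Submodule.finiteDimensional_of_le hfin
  let b := Module.finBasis F sl.range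
  choose l hl using fun i => (b i).2
  refine ⟨_, fun i => b i, fun i => ∑ k ∈ s.support, b.repr ⟨s k, e.coord k, (hs k).symm⟩ i • e k, l,
    b.linearIndependent.map' sl.range.subtype (Submodule.ker_subtype _), ?_, fun i => (hl i).symm⟩
  have hk (k) : s k = ∑ i, b.repr ⟨s k, e.coord k, (hs k).symm⟩ i • (b i : M) := by
    have := congrArg Subtype.val (b.sum_repr ⟨s k, e.coord k, (hs k).symm⟩)
    rw [AddSubmonoidClass.coe_finsetSum] at this
    exact this.symm
  conv_lhs => rw [hx]
  simp_rw [TensorProduct.tmul_sum]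
  rw [Finset.sum_comm]
  refine Finset.sum_congr rfl fun k _ => ?_
  conv_lhs => rw [hk k]
  simp_rw [TensorProduct.sum_tmul, TensorProduct.tmul_smul, TensorProduct.smul_tmul']

end Slice

variable {F H : Type*} [Field F] [CommRing H] [HopfAlgebra F H]

theorem assoc_slice {M N P : Type*} [AddCommGroup M] [Module F M] [AddCommGroup N] [Module F N]
    [AddCommGroup P] [Module F P] (l : P →ₗ[F] F) (z : (M ⊗[F] N) ⊗[F] P) :
    slice F (M ⊗[F] N) l z = (slice F N l).lTensor M (TensorProduct.assoc F M N P z) := by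
  induction z with
  | zero => simp
  | add x y hx hy => simp only [map_add, hx, hy]
  | tmul x p =>
    induction x with
    | zero => simp
    | add x y hx hy => simp only [map_add, TensorProduct.add_tmul, hx, hy]
    | tmul m n => simp

theorem slice_rTensor {M M' N : Type*} [AddCommGroup M] [Module F M] [AddCommGroup M']
    [Module F M'] [AddCommGroup N] [Module F N] (l : N →ₗ[F] F) (g : M →ₗ[F] M') (z : M ⊗[F] N) :
    slice F M' l (g.rTensor N z) = g (slice F M l z) := by
  induction z with
  | zero => simp
  | add x y hx hy => simp only [map_add, hx, hy]
  | tmul m n => simp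

/-- The coefficients of a coaction on linearly independent vectors form a comatrix. -/
theorem isComatrix_of_comul {n : ℕ} {a : Fin n → H} (ha : LinearIndependent F a)
    {c : Fin n → Fin n → H} (h : ∀ j, comul (R := F) (a j) = ∑ i, a i ⊗ₜ c i j) :
    IsComatrix F c where
  comul i k := by
    -- Both comatrix rules come from comparing the coefficients of `a i`, here in coassociativity
    -- and below in the counit axiom.
    have h' := coassoc_apply (R := F) (a k)
    simp only [h, map_sum, LinearMap.rTensor_tmul, LinearMap.lTensor_tmul, TensorProduct.sum_tmul,
      TensorProduct.assoc_tmul] at h'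
    rw [Finset.sum_comm] at h'
    simp_rw [← TensorProduct.tmul_sum] at h'
    exact (congrFun (sum_tmul_injective ha h') i).symm
  counit i k := by
    have h' := lTensor_counit_comul (R := F) (a k)
    rw [h, map_sum] at h'
    have h'' : a k ⊗ₜ[F] (1 : F) = ∑ i, a i ⊗ₜ[F] (if i = k then (1 : F) else 0) := by
      simp [TensorProduct.tmul_ite]
    rw [h''] at h'
    exact congrFun (sum_tmul_injective ha h') i

/-- Every function on an affine group scheme lies in a finite-dimensional space of functions that
is stable under translation. -/
theorem exists_comul_eq_sum (h : H) :
    ∃ (n : ℕ) (a : Fin n → H) (c : Fin n → Fin n → H) (v : Fin n → F), LinearIndependent F a ∧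
      (∀ j, comul (R := F) (a j) = ∑ i, a i ⊗ₜ c i j) ∧ h = ∑ j, v j • a j := by
  obtain ⟨n, a, b, l, ha, hab, hl⟩ := exists_slice_basis (comul (R := F) h)
  -- The `a j` form a basis of the span of the right translates of `h`. As contractions of `comul h`
  -- in the second factor, they have coproducts that coassociativity expresses through the `a i`
  -- again. The counit axiom recovers `h` with coefficients `counit (b j)`.
  refine ⟨n, a, fun i j => slice F H (l j) (comul (R := F) (b i)), fun j => counit (R := F) (b j),
    ha, fun j => ?_, ?_⟩
  · rw [hl j, ← slice_rTensor, assoc_slice, coassoc_apply, hab]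
    simp
  · have h' := congrArg (TensorProduct.rid F H) (lTensor_counit_comul (R := F) h)
    rw [hab] at h'
    simpa using h'.symm

/-- A function on an affine group scheme that is invariant under translation by the points of `Q₁`
is constant if `Q₁` maps epimorphically to the group. -/
theorem eq_algebraMap_of_mono {F : Type u} [Field F] {H H' : CommHopfAlgCat.{u} F} (f : H ⟶ H')
    [Mono f] (h : H)
    (hf : (f.hom : H →ₗ[F] H').lTensor H (comul (R := F) h) = h ⊗ₜ 1) :
    h = algebraMap F H (counit (R := F) h) := by
  obtain ⟨n, a, c, v, ha, hac, hv⟩ := exists_comul_eq_sum (F := F) h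
  have hcomul : comul (R := F) h = ∑ i, a i ⊗ₜ ∑ j, v j • c i j := by
    simp_rw [hv, map_sum, map_smul, hac, Finset.smul_sum, TensorProduct.tmul_sum,
      TensorProduct.tmul_smul]
    exact Finset.sum_comm
  have htmul {B : Type u} [CommRing B] [Algebra F B] :
      h ⊗ₜ[F] (1 : B) = ∑ i, a i ⊗ₜ algebraMap F B (v i) := by
    simp_rw [hv, TensorProduct.sum_tmul, Algebra.algebraMap_eq_smul_one, TensorProduct.tmul_smul,
      TensorProduct.smul_tmul']
  rw [hcomul, htmul, map_sum] at hf
  -- By independence of `a`, invariance of `h` says that its coordinate vector `v` is fixed after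
  -- `f`. Once `v` is fixed, `comul h = h ⊗ 1`, and applying the counit to the first factor makes
  -- `h` constant.
  have hfix := fixed_of_mono f (isComatrix_of_comul ha hac) v (congrFun (sum_tmul_injective ha hf))
  simp_rw [hfix] at hcomul
  rw [← htmul] at hcomul
  have h' := rTensor_counit_comul (R := F) h
  rw [hcomul, LinearMap.rTensor_tmul] at h'
  simpa [Algebra.algebraMap_eq_smul_one] using
    (congrArg (TensorProduct.lid F H) h').symm

end ProAlg

end

noncomputable section

namespace ProAlg

open Coalgebra

/-! ### The representation on the morphisms between equivariant objects -/

variable {F : Type u} [Field F] {C : Type w} [Category.{v} C] [Preadditive C] [Linear F C]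
variable {Λ Λ' : Type u} [CommRing Λ] [Algebra F Λ] [CommRing Λ'] [Algebra F Λ']

theorem ExtCat.trans_map_incl (φ : Λ →ₐ[F] Λ') {X Y : C} (g : X ⟶ Y) :
    (ExtCat.trans C φ).map (ExtCat.incl F Λ g) = ExtCat.incl F Λ' g := by
  change TensorProduct.map φ.toLinearMap LinearMap.id ((1 : Λ) ⊗ₜ[F] g) = (1 : Λ') ⊗ₜ g
  simp

namespace EquivObj

variable {Q : ProAlgGrp F} {A : AlgAction Q C} (X Y : EquivObj A)

/-- The action of `q ∈ Q(Λ)` on the morphisms of `C_Λ` between equivariant objects. -/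
def conj (q : Pts Q Λ) (x : (⟨X.obj⟩ : ExtCat F C Λ) ⟶ ⟨Y.obj⟩) :
    (⟨X.obj⟩ : ExtCat F C Λ) ⟶ ⟨Y.obj⟩ :=
  ((X.str Λ).α q).inv ≫ ((A.action Λ).act q).map x ≫ ((Y.str Λ).α q).hom

theorem conj_eq_iff (q : Pts Q Λ) (x y : (⟨X.obj⟩ : ExtCat F C Λ) ⟶ ⟨Y.obj⟩) :
    conj X Y q x = y ↔
      ((A.action Λ).act q).map x ≫ ((Y.str Λ).α q).hom = ((X.str Λ).α q).hom ≫ y :=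
  Iso.inv_comp_eq _

theorem conj_one (x : (⟨X.obj⟩ : ExtCat F C Λ) ⟶ ⟨Y.obj⟩) : conj X Y 1 x = x := by
  rw [conj_eq_iff, (X.str Λ).α_unit rfl, (Y.str Λ).α_unit rfl]
  exact ((A.action Λ).unit rfl).hom.naturality x

/-- The cocycle conditions for `X` and `Y`, with naturality of the multiplication isomorphism, make
conjugation a group action. -/
theorem conj_conj {q₁ q₂ q : Pts Q Λ} (h : q₂ * q₁ = q)
    (x : (⟨X.obj⟩ : ExtCat F C Λ) ⟶ ⟨Y.obj⟩) : conj X Y q₂ (conj X Y q₁ x) = conj X Y q x := by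
  rw [conj_eq_iff, ← cancel_epi (((A.action Λ).act q₂).map ((X.str Λ).α q₁).hom),
    reassoc_of% (X.str Λ).cocycle h, ← Category.assoc, ← Functor.map_comp]
  have h₁ := (conj_eq_iff X Y q₁ x _).1 rfl
  have h₂ := (conj_eq_iff X Y q x _).1 rfl
  rw [← h₁, ← h₂, Functor.map_comp, Category.assoc, (Y.str Λ).cocycle h]
  exact ((A.action Λ).mul h).hom.naturality_assoc x _

theorem trans_map_conj (φ : Λ →ₐ[F] Λ') {q : Pts Q Λ} {q' : Pts Q Λ'} (h : Pts.map Q φ q = q')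
    (x : (⟨X.obj⟩ : ExtCat F C Λ) ⟶ ⟨Y.obj⟩) :
    (ExtCat.trans C φ).map (conj X Y q x) = conj X Y q' ((ExtCat.trans C φ).map x) := by
  refine ((conj_eq_iff X Y q' _ _).2 ?_).symm
  have h₁ := congrArg (ExtCat.trans C φ).map ((conj_eq_iff X Y q x _).1 rfl)
  rw [Functor.map_comp, Functor.map_comp, X.str_base φ h, Y.str_base φ h] at h₁
  refine (cancel_epi ((A.base φ h).hom.app ⟨X.obj⟩)).1 ?_
  refine Eq.trans ?_ (h₁.trans (Category.assoc _ _ _))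
  exact ((A.base φ h).hom.naturality_assoc x _).symm

/-- A Yoneda argument: `q` is the image of the universal point, the identity of `O(Q)`, under `q`
itself as an algebra homomorphism, and `g` is already defined over `F`. -/
theorem conj_incl (g : X.obj ⟶ Y.obj) (q : Pts Q Λ) :
    conj X Y q (ExtCat.incl F Λ g) =
      q.ofConv.toLinearMap.rTensor (X.obj ⟶ Y.obj)
        (conj X Y (WithConv.toConv (AlgHom.id F Q.unop)) (ExtCat.incl F Q.unop g)) := by
  have h := trans_map_conj X Y q.ofConv (q := WithConv.toConv (AlgHom.id F Q.unop)) (q' := q)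
    rfl (ExtCat.incl F Q.unop g)
  rw [ExtCat.trans_map_incl] at h
  exact h.symm

/-- A morphism that commutes with the action of `Q₁` commutes with the action of `Q₂` if `Q₁` maps
epimorphically to `Q₂`. -/
theorem conj_incl_eq_of_epi {Q₁ Q₂ : ProAlgGrp F} (f : Q₁ ⟶ Q₂) [Epi f] {A : AlgAction Q₂ C}
    (X Y : EquivObj A) (g : X.obj ⟶ Y.obj)
    (hg : ∀ (Λ : Type u) [CommRing Λ] [Algebra F Λ] (q : Pts Q₁ Λ),
      conj X Y (Pts.push f Λ q) (ExtCat.incl F Λ g) = ExtCat.incl F Λ g)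
    (q : Pts Q₂ Λ) : conj X Y q (ExtCat.incl F Λ g) = ExtCat.incl F Λ g := by
  let ρ : Q₂.unop ⊗[F] (X.obj ⟶ Y.obj) :=
    conj X Y (WithConv.toConv (AlgHom.id F Q₂.unop)) (ExtCat.incl F Q₂.unop g)
  have hslice (Λ : Type u) [CommRing Λ] [Algebra F Λ] (q : Pts Q₂ Λ) (l : (X.obj ⟶ Y.obj) →ₗ[F] F) :
      slice F Λ l (conj X Y q (ExtCat.incl F Λ g)) = q.ofConv (slice F Q₂.unop l ρ) := by
    rw [conj_incl]
    exact slice_rTensor _ _ _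
  have hρ : ρ = (1 : Q₂.unop) ⊗ₜ g := by
    refine eq_of_forall_slice_eq fun l => ?_
    -- The universal pair of points of `Q₁` and `Q₂`; evaluating `h(q₂ f(q₁)) = h(q₂)` there yields
    -- the identity in `O(Q₂) ⊗ O(Q₁)`.
    let q₁ : Pts Q₁ (Q₂.unop ⊗[F] Q₁.unop) :=
      WithConv.toConv Algebra.TensorProduct.includeRight
    let q₂ : Pts Q₂ (Q₂.unop ⊗[F] Q₁.unop) :=
      WithConv.toConv Algebra.TensorProduct.includeLeft
    have hinv : (f.unop.hom : Q₂.unop →ₗ[F] Q₁.unop).lTensor Q₂.unop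
        (comul (R := F) (slice F Q₂.unop l ρ)) = slice F Q₂.unop l ρ ⊗ₜ 1 := by
      have h := conj_conj X Y (q₁ := Pts.push f _ q₁) (q₂ := q₂) rfl (ExtCat.incl F _ g)
      rw [hg] at h
      have h' := congrArg (slice F (Q₂.unop ⊗[F] Q₁.unop) l) h
      have h'' := (hslice _ q₂ l).symm.trans (h'.trans (hslice _ (q₂ * Pts.push f _ q₁) l))
      refine Eq.trans ?_ ((AlgHom.convMul_apply q₂ (Pts.push f _ q₁) _).symm.trans h''.symm)
      induction comul (R := F) (slice F Q₂.unop l ρ) with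
      | zero => simp
      | add x y hx hy => rw [map_add, map_add, hx, hy]
      | tmul x y => simp [q₁, q₂, Pts.push]
    -- Evaluation at the neutral element identifies the constant value as `l g`.
    have h₁ := hslice Q₂.unop 1 l
    rw [conj_one] at h₁
    rw [eq_algebraMap_of_mono f.unop _ hinv]
    exact h₁.symm
  rw [conj_incl]
  change q.ofConv.toLinearMap.rTensor (X.obj ⟶ Y.obj) ρ = (1 : Λ) ⊗ₜ g
  rw [hρ]
  simp

end EquivObj

/-! ### Properties of the restriction functor -/

variable {Q₁ Q₂ : ProAlgGrp F} (f : Q₁ ⟶ Q₂) (A : AlgAction Q₂ C)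

theorem resFunctor_faithful : (resFunctor f A).Faithful where
  map_injective h := EquivObj.Hom.ext (congrArg (EquivObj.Hom.hom (A := A.res f)) h)

theorem resFunctor_reflectsIsomorphisms : (resFunctor f A).ReflectsIsomorphisms where
  reflects {X Y} g _ := by
    let i : Y.obj ⟶ X.obj := EquivObj.Hom.hom (A := A.res f) (inv ((resFunctor f A).map g))
    have hgi : g.hom ≫ i = 𝟙 X.obj :=
      congrArg (EquivObj.Hom.hom (A := A.res f)) (IsIso.hom_inv_id ((resFunctor f A).map g))
    have hig : i ≫ g.hom = 𝟙 Y.obj :=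
      congrArg (EquivObj.Hom.hom (A := A.res f)) (IsIso.inv_hom_id ((resFunctor f A).map g))
    have hgi' (Λ : Type u) [CommRing Λ] [Algebra F Λ] :
        ExtCat.incl F Λ g.hom ≫ ExtCat.incl F Λ i = 𝟙 _ := by
      rw [← ExtCat.incl_comp, hgi, ExtCat.incl_id]
    have hig' (Λ : Type u) [CommRing Λ] [Algebra F Λ] :
        ExtCat.incl F Λ i ≫ ExtCat.incl F Λ g.hom = 𝟙 _ := by
      rw [← ExtCat.incl_comp, hig, ExtCat.incl_id]
    let j : Y ⟶ X :=
      { hom := i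
        comm Λ _ _ q := by
          -- Equivariance of `g`, multiplied by `q · i` on one side and by `i` on the other, becomes
          -- equivariance of `i`.
          have h := congrArg (fun z => ((A.action Λ).act q).map (ExtCat.incl F Λ i) ≫ z ≫
            ExtCat.incl F Λ i) (g.comm Λ q)
          simp only [Category.assoc, hgi', Category.comp_id] at h
          rw [← h, ← Functor.map_comp_assoc, hig', CategoryTheory.Functor.map_id,
            Category.id_comp] }
    exact ⟨j, EquivObj.Hom.ext hgi, EquivObj.Hom.ext hig⟩

theorem resFunctor_full [Epi f] : (resFunctor f A).Full where
  map_surjective {X Y} g :=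
    ⟨{ hom := g.hom
       comm _ _ _ q := (EquivObj.conj_eq_iff X Y q _ _).1
        (EquivObj.conj_incl_eq_of_epi f X Y g.hom
          (fun Λ _ _ q => (EquivObj.conj_eq_iff X Y (Pts.push f Λ q) _ _).2 (g.comm Λ q)) q) },
      rfl⟩

end ProAlg

end

theorem mainTheorem8 {F : Type u} [Field F] [CharZero F] {Q₁ Q₂ : ProAlg.ProAlgGrp F}
    (f : Q₁ ⟶ Q₂) {C : Type w} [Category.{v} C] [Preadditive C] [Linear F C]
    (A : ProAlg.AlgAction Q₂ C) :
    (ProAlg.resFunctor f A).Faithful ∧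
      (ProAlg.resFunctor f A).ReflectsIsomorphisms ∧
      (Epi f → (ProAlg.resFunctor f A).Full) :=
  ⟨ProAlg.resFunctor_faithful f A, ProAlg.resFunctor_reflectsIsomorphisms f A,
    fun _ => ProAlg.resFunctor_full f A⟩
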